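/- Let $d \in \mathbb{N}$, let $M \in \mathbb{R}^{d\times d}$ be symmetric positive semidefinite, let $r$ belong to the range of $M$, and let $\ell(x) = \frac12 \langle x, Mx\rangle - \langle r, x\rangle$ for $x \in \mathbb{R}^d$. For $\lambda > 0$ let $\mathrm{Lasso}(x,\lambda) = \ell(x) + \lambda \|x\|_1$ and $\mathrm{Lasso}_*(\lambda) = \min_{z\in\mathbb{R}^d} \mathrm{Lasso}(z,\lambda)$. Write $\circ$ for the component-wise product. Let $\beta, \gamma \in \mathbb{R}^d$ satisfy $\beta_i \neq \pm\gamma_i$ for all $i \in \{1,\dots,d\}$. For $\varepsilon > 0$, let $(u^\varepsilon(t), v^\varepsilon(t))$, $t \geq 0$, be the solution of the gradient flow $$\frac{\mathrm{d}u}{\mathrm{d}t} = -\nabla_u\big(\ell(u\circ v)\big), \qquad \frac{\mathrm{d}v}{\mathrm{d}t} = -\nabla_v\big(\ell(u\circ v)\big), \qquad u(0) = \sqrt{\varepsilon}\,\beta, \quad v(0) = \sqrt{\varepsilon}\,\gamma,$$ and let $x^\varepsilon(t) = u^\varepsilon(t)\circ v^\varepsilon(t)$ and $\overline{x}^\varepsilon(t)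 = \frac1t \int_0^t x^\varepsilon(\tau)\,\mathrm{d}\tau$. For every $s > 0$, let $x(s)$ be a minimizer of $\mathrm{Lasso}(\cdot, \frac1s)$ over $\mathbb{R}^d$, and assume that $s \mapsto s\,x(s)$ is coordinate-wise monotone on $(0,\infty)$, that is, for each $i$ the function $s \mapsto s\,x_i(s)$ is nondecreasing or nonincreasing on $(0,\infty)$. Then for every $s > 0$, with $t(s,\varepsilon) = \frac12 \big(\log\frac1\varepsilon\big)\, s$, $$\mathrm{Lasso}\Big(\overline{x}^\varepsilon\big(t(s,\varepsilon)\big), \tfrac1s\Big) \longrightarrow \mathrm{Lasso}_*\Big(\tfrac1s\Big) \qquad \text{as } \varepsilon \to 0^+ .$$ -/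

import Mathlib

open Set Filter Topology MeasureTheory
open scoped RealInnerProductSpace

namespace DLN

noncomputable section

/-- The component-wise product of two vectors of `ℝ^d`. -/
def hadamard {d : ℕ} (u v : EuclideanSpace ℝ (Fin d)) : EuclideanSpace ℝ (Fin d) :=
  WithLp.toLp 2 (fun i => u i * v i)

/-- The quadratic loss `ℓ(x) = ½ ⟨x, M x⟩ - ⟨r, x⟩`. -/
def loss {d : ℕ} (M : Matrix (Fin d) (Fin d) ℝ) (r x : EuclideanSpace ℝ (Fin d)) : ℝ :=
  (1 / 2) * ⟪x, Matrix.toEuclideanLin M x⟫ - ⟪r, x⟫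

/-- The lasso objective `Lasso(x, lam) = ℓ(x) + lam ‖x‖₁`. -/
def lasso {d : ℕ} (M : Matrix (Fin d) (Fin d) ℝ) (r x : EuclideanSpace ℝ (Fin d))
    (lam : ℝ) : ℝ :=
  loss M r x + lam * ∑ i, |x i|

/-- The optimal value of the lasso problem over `ℝ^d`
(it is attained as soon as the lasso problem has a minimizer). -/
def lassoMin {d : ℕ} (M : Matrix (Fin d) (Fin d) ℝ) (r : EuclideanSpace ℝ (Fin d))
    (lam : ℝ) : ℝ :=
  ⨅ z : EuclideanSpace ℝ (Fin d), lasso M r z lam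

/-- `(u, v)` solves on `[0, ∞)` the gradient flow of `(u, v) ↦ ℓ(u ∘ v)`, started from `(u₀, v₀)`:
`u' = -∇_u (ℓ(u ∘ v))`, `v' = -∇_v (ℓ(u ∘ v))`. -/
structure IsGradientFlow {d : ℕ} (M : Matrix (Fin d) (Fin d) ℝ) (r : EuclideanSpace ℝ (Fin d))
    (u₀ v₀ : EuclideanSpace ℝ (Fin d)) (u v : ℝ → EuclideanSpace ℝ (Fin d)) : Prop where
  init_u : u 0 = u₀
  init_v : v 0 = v₀
  deriv_u : ∀ t, 0 ≤ t →
    HasDerivWithinAt u (-gradient (fun a => loss M r (hadamard a (v t))) (u t)) (Ici 0) t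
  deriv_v : ∀ t, 0 ≤ t →
    HasDerivWithinAt v (-gradient (fun b => loss M r (hadamard (u t) b)) (v t)) (Ici 0) t

/-- The running average `(1 / t) ∫₀ᵗ x(τ) dτ` of a trajectory. -/
def timeAverage {d : ℕ} (x : ℝ → EuclideanSpace ℝ (Fin d)) (t : ℝ) : EuclideanSpace ℝ (Fin d) :=
  (1 / t) • ∫ τ in (0 : ℝ)..t, x τ

/-- The original time `t = (log (1 / ε) / 2) s` that corresponds to the rescaled time `s`. -/
def originalTime (ε s : ℝ) : ℝ :=
  Real.log (1 / ε) / 2 * s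

end

end DLN

namespace DLN

/-! Each coordinate of `u + v` and `u - v` solves a scalar linear equation, with opposite rates.
Solving them shows that, for `L = log (1/ε)`, the curve `y(s) = s x̄(t(s, ε))` satisfies `y' =
speed(w)` coordinatewise, where `w = s r - M y` (`IsGradientFlow.hadamard_eq_speed`). For large `L`
the speed is tiny when `w` is well inside the unit box and huge well outside it: `y'` is almost an
outward normal to the box at `w`. The rescaled lasso path `z(s) = s x(s)` has its dual vector in the
box, extremal wherever `z_i ≠ 0`, so monotonicity makes its increments outward normals as well.

Since `M (y - z)` is the difference of the two dual vectors, the energy `½⟨y - z, M (y - z)⟩` can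
hardly grow (`AveragedFlow.energy_le`). The growth of the objective gap is then governed by `⟨r, z -
y⟩`, which the energy controls because `r` is in the range of `M`
(`AveragedFlow.scaledLasso_sub_le`). The overshoot of the box is `O(L^(-1/2))`, hence so is the
energy, and the gap is `O(L^(-1/4))`.

The path `z` is not known to be differentiable, so evolution inequalities are stated on increments
with an error quadratic in the step, which `le_of_increment_le_sq` removes. -/

/-- A function whose increments are bounded by a quadratic in the step is nonincreasing. -/
lemma le_of_increment_le_sq {φ : ℝ → ℝ} {K S : ℝ} (hS : 0 ≤ S)
    (h : ∀ a b, 0 ≤ a → a ≤ b → b ≤ S → φ b - φ a ≤ K * (b - a) ^ 2) : φ S ≤ φ 0 := by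
  -- Over `n + 1` equal steps the quadratic errors add up to `K S² / (n + 1)`.
  have key : ∀ n : ℕ, φ S - φ 0 ≤ K * S ^ 2 / ((n : ℝ) + 1) := by
    intro n
    have hn : (0 : ℝ) < (n : ℝ) + 1 := by positivity
    have hk : ∀ k : ℕ, k ≤ n + 1 →
        φ (k * (S / (n + 1))) - φ 0 ≤ k * (K * (S / (n + 1)) ^ 2) := by
      intro k
      induction k with
      | zero => intro _; simp
      | succ k ih =>
        intro hk
        have h1 := ih (by omega)
        have hstep : (0 : ℝ) ≤ S / (n + 1) := by positivity
        have h2 := h (k * (S / (n + 1))) ((k + 1 : ℕ) * (S / (n + 1))) (by positivity)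
          (by push_cast; nlinarith) (by
            have : ((k + 1 : ℕ) : ℝ) ≤ n + 1 := by exact_mod_cast hk
            calc ((k + 1 : ℕ) : ℝ) * (S / (n + 1)) ≤ (n + 1) * (S / (n + 1)) := by gcongr
              _ = S := by field_simp)
        have h3 : ((k + 1 : ℕ) : ℝ) * (S / (n + 1)) - k * (S / (n + 1)) = S / (n + 1) := by
          push_cast; ring
        rw [h3] at h2
        push_cast at h2 ⊢
        linarith
    have h1 := hk (n + 1) le_rfl
    have h2 : ((n + 1 : ℕ) : ℝ) * (S / (n + 1)) = S := by push_cast; field_simp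
    rw [h2] at h1
    refine h1.trans (le_of_eq ?_)
    push_cast
    field_simp
  have hlim : Tendsto (fun n : ℕ => K * S ^ 2 / ((n : ℝ) + 1)) atTop (𝓝 0) :=
    tendsto_const_div_atTop_nhds_zero_nat (K * S ^ 2) |>.comp (tendsto_add_atTop_nat 1) |>.congr
      (fun n => by simp)
  linarith [ge_of_tendsto' hlim key]

/-! ### Positive semidefinite quadratic forms -/

lemma isSymm_of_posSemidef {ι : Type*} {M : Matrix ι ι ℝ} (hM : M.PosSemidef) : M.IsSymm := by
  have := hM.isHermitian
  rwa [Matrix.IsHermitian, Matrix.conjTranspose_eq_transpose_of_trivial] at this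

variable {ι : Type*} [Fintype ι]

lemma dotProduct_mulVec_comm_of_isSymm {M : Matrix ι ι ℝ} (hM : M.IsSymm) (a b : ι → ℝ) :
    dotProduct a (M.mulVec b) = dotProduct b (M.mulVec a) := by
  rw [Matrix.dotProduct_mulVec, ← Matrix.mulVec_transpose, hM.eq, dotProduct_comm]

lemma dotProduct_mulVec_self_nonneg {M : Matrix ι ι ℝ} (hM : M.PosSemidef) (a : ι → ℝ) :
    0 ≤ dotProduct a (M.mulVec a) := by
  simpa using hM.dotProduct_mulVec_nonneg a

lemma quadratic_sub_le {M : Matrix ι ι ℝ} (hM : M.PosSemidef) (a b : ι → ℝ) :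
    1 / 2 * dotProduct b (M.mulVec b) - 1 / 2 * dotProduct a (M.mulVec a)
      ≤ dotProduct (b - a) (M.mulVec b) := by
  have h := dotProduct_mulVec_self_nonneg hM (b - a)
  have h2 := dotProduct_mulVec_comm_of_isSymm (isSymm_of_posSemidef hM) a b
  simp only [Matrix.mulVec_sub, dotProduct_sub, sub_dotProduct] at *
  linarith

/-- Expand the form at `κ a - b`. This turns smallness of the energy of `b` into smallness of its
pairing with a vector `M a` of the range. -/
lemma dotProduct_mulVec_le_young {M : Matrix ι ι ℝ} (hM : M.PosSemidef) (a b : ι → ℝ) {κ : ℝ}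
    (hκ : 0 < κ) :
    dotProduct a (M.mulVec b) ≤
      κ / 2 * dotProduct a (M.mulVec a) + 1 / 2 * dotProduct b (M.mulVec b) / κ := by
  have h := dotProduct_mulVec_self_nonneg hM (κ • a - b)
  have h2 := dotProduct_mulVec_comm_of_isSymm (isSymm_of_posSemidef hM) a b
  simp only [Matrix.mulVec_sub, dotProduct_sub, sub_dotProduct, Matrix.mulVec_smul,
    dotProduct_smul, smul_dotProduct, smul_eq_mul] at h
  rw [← h2] at h
  have h3 : κ / 2 * dotProduct a (M.mulVec a) + 1 / 2 * dotProduct b (M.mulVec b) / κ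
      - dotProduct a (M.mulVec b) = (κ * (κ * dotProduct a (M.mulVec a)) -
        κ * dotProduct a (M.mulVec b) - (κ * dotProduct a (M.mulVec b)
        - dotProduct b (M.mulVec b))) / (2 * κ) := by
    field_simp; ring
  have h4 := div_nonneg h (by positivity : 0 ≤ 2 * κ)
  rw [mul_sub] at h4
  linarith [h3, h4]

/-! ### Optimality conditions for the rescaled lasso -/

/-- The lasso objective after the change of variable `z = s x`, multiplied by `s ^ 2`. -/
noncomputable def scaledLasso (M : Matrix ι ι ℝ) (r : ι → ℝ) (s : ℝ) (z : ι → ℝ) : ℝ :=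
  1 / 2 * dotProduct z (M.mulVec z) - s * dotProduct r z + ∑ i, |z i|

/-- The dual certificate `s r - M z`. -/
noncomputable def dualVec (M : Matrix ι ι ℝ) (r : ι → ℝ) (s : ℝ) (z : ι → ℝ) : ι → ℝ :=
  s • r - M.mulVec z

lemma scaledLasso_update {M : Matrix ι ι ℝ} [DecidableEq ι] (hM : M.PosSemidef) (r : ι → ℝ)
    (s : ℝ) (z : ι → ℝ) (i : ι) (t : ℝ) :
    scaledLasso M r s (z + Pi.single i t) - scaledLasso M r s z =
      t ^ 2 / 2 * M i i - t * dualVec M r s z i + (|z i + t| - |z i|) := by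
  have h1 : ∑ j, |(z + Pi.single i t : ι → ℝ) j| - ∑ j, |z j| = |z i + t| - |z i| := by
    rw [← Finset.sum_sub_distrib, Finset.sum_eq_single i]
    · simp
    · intro j _ hj; simp [hj]
    · simp
  have h2 := dotProduct_mulVec_comm_of_isSymm (isSymm_of_posSemidef hM) z (Pi.single i t)
  have h3 : dotProduct (Pi.single i t) (M.mulVec (Pi.single i t)) = t ^ 2 * M i i := by
    simp [Matrix.mulVec_single]; ring
  have h4 : dotProduct (Pi.single i t) (M.mulVec z) = t * M.mulVec z i := by simp
  have h5 : dotProduct r (Pi.single i t) = r i * t := by simp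
  unfold scaledLasso dualVec
  simp only [Matrix.mulVec_add, dotProduct_add, add_dotProduct, h3, h2, h4, h5]
  simp only [Pi.sub_apply, Pi.smul_apply, smul_eq_mul]
  simp only [Pi.add_apply] at h1
  simp only [Pi.add_apply]
  linear_combination h1

lemma nonpos_of_forall_mul_le_sq {A B : ℝ} (h : ∀ t : ℝ, 0 < t → t < 1 → t * A ≤ t ^ 2 * B) :
    A ≤ 0 := by
  have h1 : ∀ᶠ t : ℝ in 𝓝[>] 0, A ≤ t * B := by
    filter_upwards [Ioo_mem_nhdsGT (zero_lt_one' ℝ)] with t ht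
    have := h t ht.1 ht.2
    rw [pow_two, mul_assoc] at this
    exact le_of_mul_le_mul_left this ht.1
  have h2 : Tendsto (fun t : ℝ => t * B) (𝓝[>] 0) (𝓝 0) := by
    have : ContinuousAt (fun t : ℝ => t * B) 0 := by fun_prop
    simpa using this.tendsto.mono_left nhdsWithin_le_nhds
  exact ge_of_tendsto h2 h1

/-- Moving one coordinate by `±t` costs at most `t` in the `ℓ¹` norm; compare first-order terms. -/
lemma abs_dualVec_le_one {M : Matrix ι ι ℝ} (hM : M.PosSemidef) {r : ι → ℝ} {s : ℝ}
    {z : ι → ℝ} (hz : ∀ y, scaledLasso M r s z ≤ scaledLasso M r s y) (i : ι) :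
    |dualVec M r s z i| ≤ 1 := by
  classical
  have h : ∀ t : ℝ, t * dualVec M r s z i ≤ t ^ 2 / 2 * M i i + |t| := by
    intro t
    have h1 := scaledLasso_update hM r s z i t
    have h2 := hz (z + Pi.single i t)
    have h3 := abs_add_le (z i) t
    linarith
  rw [abs_le]
  constructor
  · have := nonpos_of_forall_mul_le_sq (A := - dualVec M r s z i - 1) (B := M i i / 2) (by
      intro t ht _
      have := h (-t)
      rw [abs_neg, abs_of_pos ht] at this
      nlinarith)
    linarith
  · have := nonpos_of_forall_mul_le_sq (A := dualVec M r s z i - 1) (B := M i i / 2) (by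
      intro t ht _
      have := h t
      rw [abs_of_pos ht] at this
      nlinarith)
    linarith

/-- Shrinking one coordinate by the factor `1 - t` saves exactly `t |z i|` in the `ℓ¹` norm.
Together with the box bound this is complementary slackness. -/
lemma abs_le_dualVec_mul {M : Matrix ι ι ℝ} (hM : M.PosSemidef) {r : ι → ℝ} {s : ℝ}
    {z : ι → ℝ} (hz : ∀ y, scaledLasso M r s z ≤ scaledLasso M r s y) (i : ι) :
    |z i| ≤ dualVec M r s z i * z i := by
  classical
  have := nonpos_of_forall_mul_le_sq (A := |z i| - dualVec M r s z i * z i)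
    (B := z i ^ 2 * M i i / 2) (by
      intro t ht ht1
      have h1 := scaledLasso_update hM r s z i (-t * z i)
      have h2 := hz (z + Pi.single i (-t * z i))
      have h3 : |z i + -t * z i| = (1 - t) * |z i| := by
        rw [show z i + -t * z i = (1 - t) * z i by ring, abs_mul, abs_of_pos (by linarith)]
      rw [h3] at h1
      nlinarith)
  linarith

/-- For small `s` the penalty dominates the linear term. This is what extends monotonicity of the
path to `s = 0`. -/
lemma eq_zero_of_isMin_of_small {M : Matrix ι ι ℝ} (hM : M.PosSemidef) {r : ι → ℝ} {s : ℝ}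
    {z : ι → ℝ} (hz : ∀ y, scaledLasso M r s z ≤ scaledLasso M r s y) (hs : 0 ≤ s)
    (hsr : s * ∑ i, |r i| < 1) : z = 0 := by
  have h0 := hz 0
  simp only [scaledLasso, Matrix.mulVec_zero, dotProduct_zero, Pi.zero_apply, abs_zero,
    Finset.sum_const_zero, mul_zero, sub_zero, add_zero] at h0
  have h1 := dotProduct_mulVec_self_nonneg hM z
  have h2 : dotProduct r z ≤ (∑ i, |r i|) * ∑ i, |z i| := by
    rw [Finset.mul_sum]
    refine Finset.sum_le_sum fun i _ => ?_
    calc r i * z i ≤ |r i| * |z i| := by rw [← abs_mul]; exact le_abs_self _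
      _ ≤ _ := by
        gcongr
        exact Finset.single_le_sum (f := fun i => |r i|) (fun j _ => abs_nonneg _)
          (Finset.mem_univ i)
  have h3 : 0 ≤ ∑ i, |z i| := Finset.sum_nonneg fun i _ => abs_nonneg _
  have h4 : ∑ i, |z i| = 0 := by nlinarith [mul_le_mul_of_nonneg_left h2 hs]
  funext i
  have := (Finset.sum_eq_zero_iff_of_nonneg (fun j _ => abs_nonneg (z j))).1 h4 i
    (Finset.mem_univ i)
  simpa using this

/-! ### Velocity of a coordinate and overshoot of the box -/

lemma mul_exp_neg_le {L a : ℝ} (hL : 0 < L) : a * Real.exp (-(L * a)) ≤ 1 / L := by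
  rw [Real.exp_neg, ← div_eq_mul_inv, div_le_div_iff₀ (Real.exp_pos _) hL]
  linarith [Real.add_one_le_exp (L * a)]

/-- The velocity of a coordinate of the averaged flow as a function of its dual variable. -/
noncomputable def speed (p q L w : ℝ) : ℝ :=
  1 / 4 * (p * Real.exp (-(L * (1 - w))) - q * Real.exp (-(L * (1 + w))))

/-- Approximate normal-cone inequality: `c - w ≤ 1 - w` meets the first exponential and `w - c ≤ 1 +
w` the second, so each product is at most `1 / L` by `mul_exp_neg_le`. -/
lemma speed_mul_sub_le {p q L w c : ℝ} (hp : 0 ≤ p) (hq : 0 ≤ q) (hL : 0 < L) (hc : |c| ≤ 1) :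
    speed p q L w * (c - w) ≤ (p + q) / 4 / L := by
  rw [abs_le] at hc
  have h1 : p * ((c - w) * Real.exp (-(L * (1 - w)))) ≤ p * (1 / L) := by
    refine mul_le_mul_of_nonneg_left (le_trans ?_ (mul_exp_neg_le (a := 1 - w) hL)) hp
    gcongr; exact hc.2
  have h2 : q * ((w - c) * Real.exp (-(L * (1 + w)))) ≤ q * (1 / L) := by
    refine mul_le_mul_of_nonneg_left (le_trans ?_ (mul_exp_neg_le (a := 1 + w) hL)) hq
    gcongr; linarith
  have h3 : (p + q) / 4 / L = 1 / 4 * (p * (1 / L) + q * (1 / L)) := by ring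
  rw [h3, speed]
  linarith

/-- Beyond the face `w = 1` the speed is exponentially large in `L (w - 1)`. The cruder bound `exp x
≥ x² / 2` is enough: for `B` of order `L` the overshoot is still `O(L^(-1/2))`. -/
lemma le_one_add_of_speed_le {p q L w B : ℝ} (hp : 0 < p) (hq : 0 ≤ q) (hL : 0 < L)
    (h : speed p q L w ≤ B) : w ≤ 1 + √(2 * (4 * B + q) / p) / L := by
  have hs : 0 ≤ √(2 * (4 * B + q) / p) / L := by positivity
  by_cases hw : w ≤ 1
  · linarith
  push Not at hw
  have h1 : Real.exp (-(L * (1 + w))) ≤ 1 := Real.exp_le_one_iff.2 (by nlinarith)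
  have h2 : p * Real.exp (L * (w - 1)) ≤ 4 * B + q := by
    rw [speed, show -(L * (1 - w)) = L * (w - 1) by ring] at h
    nlinarith
  have hx : 0 ≤ L * (w - 1) := by nlinarith
  have h3 := Real.quadratic_le_exp_of_nonneg hx
  have h4 : (L * (w - 1)) ^ 2 ≤ 2 * (4 * B + q) / p := by
    rw [le_div_iff₀ hp]
    nlinarith
  have h5 := Real.le_sqrt_of_sq_le h4
  have : w - 1 ≤ √(2 * (4 * B + q) / p) / L := by rw [le_div_iff₀ hL]; linarith
  linarith

lemma speed_neg (p q L w : ℝ) : speed q p L (-w) = - speed p q L w := by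
  simp only [speed, sub_neg_eq_add, ← sub_eq_add_neg]; ring

lemma abs_le_one_add_of_abs_speed_le {p q L w B m Q : ℝ} (hm : 0 < m) (hp : m ≤ p) (hq : m ≤ q)
    (hpQ : p ≤ Q) (hqQ : q ≤ Q) (hL : 0 < L) (h : |speed p q L w| ≤ B) :
    |w| ≤ 1 + √(2 * (4 * B + Q) / m) / L := by
  have hB := (abs_nonneg _).trans h
  rw [abs_le] at h
  have hp0 : 0 < p := hm.trans_le hp
  have hq0 : 0 < q := hm.trans_le hq
  have hQ : 0 < Q := hp0.trans_le hpQ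
  rw [abs_le']
  constructor
  · refine (le_one_add_of_speed_le hp0 hq0.le hL h.2).trans ?_
    gcongr
  · refine (le_one_add_of_speed_le (w := -w) (q := p) hq0 hp0.le hL
      (by rw [speed_neg]; linarith [h.1] : speed q p L (-w) ≤ B)).trans ?_
    gcongr

/-! ### Comparison of the averaged flow with the lasso path -/

lemma sub_le_mul_of_hasDerivWithinAt_Ici {f f' : ℝ → ℝ} {a b C : ℝ} (ha : 0 ≤ a) (hab : a ≤ b)
    (h : ∀ t, a ≤ t → t ≤ b → HasDerivWithinAt f (f' t) (Ici 0) t)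
    (hC : ∀ t, a ≤ t → t ≤ b → f' t ≤ C) : f b - f a ≤ C * (b - a) := by
  have hd : ∀ t ∈ interior (Icc a b), HasDerivAt f (f' t) t := by
    intro t ht
    rw [interior_Icc] at ht
    exact (h t ht.1.le ht.2.le).hasDerivAt (Ici_mem_nhds (ha.trans_lt ht.1))
  refine (convex_Icc a b).image_sub_le_mul_sub_of_deriv_le ?_ ?_ ?_ a (left_mem_Icc.2 hab) b
    (right_mem_Icc.2 hab) hab
  · intro t ht
    exact (h t ht.1 ht.2).continuousWithinAt.mono fun x hx => ha.trans hx.1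
  · exact fun t ht => (hd t ht).differentiableAt.differentiableWithinAt
  · intro t ht
    rw [(hd t ht).deriv]
    rw [interior_Icc] at ht
    exact hC t ht.1.le ht.2.le

lemma abs_sub_le_mul_of_hasDerivWithinAt_Ici {f f' : ℝ → ℝ} {a b C : ℝ} (ha : 0 ≤ a)
    (hab : a ≤ b) (h : ∀ t, a ≤ t → t ≤ b → HasDerivWithinAt f (f' t) (Ici 0) t)
    (hC : ∀ t, a ≤ t → t ≤ b → |f' t| ≤ C) : |f b - f a| ≤ C * (b - a) := by
  rw [abs_le']
  refine ⟨sub_le_mul_of_hasDerivWithinAt_Ici ha hab h fun t h1 h2 => (abs_le.1 (hC t h1 h2)).2, ?_⟩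
  have := sub_le_mul_of_hasDerivWithinAt_Ici (f := fun t => - f t) (f' := fun t => - f' t)
    (C := C) ha hab (fun t h1 h2 => (h t h1 h2).neg) fun t h1 h2 => by
      linarith [(abs_le.1 (hC t h1 h2)).1]
  linarith

/-- `y` is the rescaled integral of the trajectory: it starts at `0` and its velocity is
`speed` evaluated at the dual variable. -/
structure AveragedFlow (M : Matrix ι ι ℝ) (r p q : ι → ℝ) (L : ℝ) (y : ℝ → ι → ℝ) : Prop where
  init : y 0 = 0
  deriv : ∀ s, 0 ≤ s → ∀ i, HasDerivWithinAt (fun τ => y τ i)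
    (speed (p i) (q i) L (dualVec M r s (y s) i)) (Ici 0) s

lemma abs_dualVec_sub_le {M : Matrix ι ι ℝ} {r : ι → ℝ} {y : ℝ → ι → ℝ} {a b B : ℝ} (hab : a ≤ b)
    (h : ∀ i, |y b i - y a i| ≤ B * (b - a)) (i : ι) :
    |dualVec M r b (y b) i - dualVec M r a (y a) i| ≤ (|r i| + ∑ j, |M i j| * B) * (b - a) := by
  have h1 : dualVec M r b (y b) i - dualVec M r a (y a) i =
      (b - a) * r i - ∑ j, M i j * (y b j - y a j) := by
    simp only [dualVec, Pi.sub_apply, Pi.smul_apply, smul_eq_mul, Matrix.mulVec, dotProduct,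
      mul_sub, Finset.sum_sub_distrib]
    ring
  rw [h1, add_mul, Finset.sum_mul]
  refine (abs_sub _ _).trans (add_le_add ?_ ?_)
  · rw [abs_mul, abs_of_nonneg (sub_nonneg.2 hab), mul_comm]
  · refine (Finset.abs_sum_le_sum_abs _ _).trans (Finset.sum_le_sum fun j _ => ?_)
    rw [abs_mul, mul_assoc]
    exact mul_le_mul_of_nonneg_left (h j) (abs_nonneg _)

section Flow

variable {M : Matrix ι ι ℝ} {r p q : ι → ℝ} {L S B : ℝ} {y : ℝ → ι → ℝ}

lemma AveragedFlow.abs_sub_le (hy : AveragedFlow M r p q L y)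
    (hB : ∀ s, 0 ≤ s → s ≤ S → ∀ i, |speed (p i) (q i) L (dualVec M r s (y s) i)| ≤ B)
    {a b : ℝ} (ha : 0 ≤ a) (hab : a ≤ b) (hb : b ≤ S) (i : ι) :
    |y b i - y a i| ≤ B * (b - a) :=
  abs_sub_le_mul_of_hasDerivWithinAt_Ici (f := fun t => y t i) ha hab
    (fun t h1 _ => hy.deriv t (ha.trans h1) i)
    fun t h1 h2 => hB t (ha.trans h1) (h2.trans hb) i

/-- Integrates `speed_mul_sub_le` with the dual variable frozen at the right endpoint; its Lipschitz
variation gives the quadratic error. `K` may depend on `L`, since it disappears as the steps shrink.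
-/
lemma AveragedFlow.exists_increment_le (hy : AveragedFlow M r p q L y)
    (hp : ∀ i, 0 ≤ p i) (hq : ∀ i, 0 ≤ q i) (hL : 0 < L)
    (hB : ∀ s, 0 ≤ s → s ≤ S → ∀ i, |speed (p i) (q i) L (dualVec M r s (y s) i)| ≤ B) :
    ∃ K, ∀ a b, 0 ≤ a → a ≤ b → b ≤ S → ∀ c : ι → ℝ, (∀ i, |c i| ≤ 1) →
      dotProduct (y b - y a) (c - dualVec M r b (y b)) ≤
        (∑ i, (p i + q i) / 4) / L * (b - a) + K * (b - a) ^ 2 := by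
  refine ⟨∑ i, B * (|r i| + ∑ j, |M i j| * B), fun a b ha hab hb c hc => ?_⟩
  rw [Finset.sum_div, Finset.sum_mul, Finset.sum_mul, ← Finset.sum_add_distrib]
  refine Finset.sum_le_sum fun i _ => ?_
  set D := c i - dualVec M r b (y b) i with hD
  have hBab : 0 ≤ B := (abs_nonneg _).trans (hB a ha (hab.trans hb) i)
  have hlip : ∀ t, a ≤ t → t ≤ b → |dualVec M r b (y b) i - dualVec M r t (y t) i| ≤
      (|r i| + ∑ j, |M i j| * B) * (b - a) := by
    intro t h1 h2
    refine (abs_dualVec_sub_le h2 (hy.abs_sub_le hB (ha.trans h1) h2 hb) i).trans ?_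
    have : 0 ≤ |r i| + ∑ j, |M i j| * B := by
      have : 0 ≤ ∑ j, |M i j| * B := Finset.sum_nonneg fun j _ => by positivity
      positivity
    gcongr
  have hmain := sub_le_mul_of_hasDerivWithinAt_Ici (f := fun t => y t i * D)
    (C := (p i + q i) / 4 / L + B * ((|r i| + ∑ j, |M i j| * B) * (b - a))) ha hab
    (fun t h1 _ => (hy.deriv t (ha.trans h1) i).mul_const D) (fun t h1 h2 => by
      set w := dualVec M r t (y t) i with hw
      have e1 : speed (p i) (q i) L w * D = speed (p i) (q i) L w * (c i - w)
          + speed (p i) (q i) L w * (w - dualVec M r b (y b) i) := by rw [hD]; ring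
      rw [e1]
      refine add_le_add (speed_mul_sub_le (hp i) (hq i) hL (hc i)) ?_
      refine (le_abs_self _).trans ?_
      rw [abs_mul]
      refine mul_le_mul (hB t (ha.trans h1) (h2.trans hb) i) ?_ (abs_nonneg _) hBab
      rw [abs_sub_comm]
      exact hlip t h1 h2)
  simp only [Pi.sub_apply, ← hD]
  linarith

variable {z : ℝ → ι → ℝ}

lemma abs_le_abs_of_monotoneOn {f : ℝ → ℝ} (h0 : f 0 = 0)
    (h : MonotoneOn f (Ici 0) ∨ AntitoneOn f (Ici 0)) {a b : ℝ} (ha : 0 ≤ a) (hab : a ≤ b) :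
    |f a| ≤ |f b| := by
  have hb := ha.trans hab
  rcases h with h | h
  · have h1 := h (mem_Ici.2 le_rfl) ha ha
    have h2 := h ha hb hab
    rw [abs_of_nonneg (by linarith), abs_of_nonneg (by linarith)]; exact h2
  · have h1 := h (mem_Ici.2 le_rfl) ha ha
    have h2 := h ha hb hab
    rw [abs_of_nonpos (by linarith), abs_of_nonpos (by linarith)]; linarith

/-- A monotone path from `0` whose dual variable is extremal wherever the path is nonzero can only
push against dual variables `w` that exceed the unit box. -/
lemma sub_mul_sub_le_of_monotoneOn {f : ℝ → ℝ} (h0 : f 0 = 0)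
    (h : MonotoneOn f (Ici 0) ∨ AntitoneOn f (Ici 0)) {a b c w η : ℝ} (ha : 0 ≤ a) (hab : a ≤ b)
    (hc : |f b| ≤ c * f b) (hw : |w| ≤ 1 + η) :
    -((f b - f a) * (c - w)) ≤ η * (|f b| - |f a|) := by
  have hb := ha.trans hab
  rw [abs_le] at hw
  rcases h with h | h
  · have h1 := h (mem_Ici.2 le_rfl) ha ha
    have h2 := h ha hb hab
    rw [h0] at h1
    rw [abs_of_nonneg (h1.trans h2)] at hc ⊢
    rw [abs_of_nonneg h1]
    rcases (h1.trans h2).eq_or_lt with h3 | h3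
    · have : f a = 0 := by linarith
      rw [this, ← h3]; simp
    · have : 1 ≤ c := by by_contra! hc1; nlinarith
      nlinarith
  · have h1 := h (mem_Ici.2 le_rfl) ha ha
    have h2 := h ha hb hab
    rw [h0] at h1
    rw [abs_of_nonpos (h2.trans h1)] at hc ⊢
    rw [abs_of_nonpos h1]
    rcases (h2.trans h1).eq_or_lt with h3 | h3
    · have : f a = 0 := by linarith
      rw [this, h3]; simp
    · have : c ≤ -1 := by by_contra! hc1; nlinarith
      nlinarith

/-- By convexity an energy increment is at most the increment of `y - z` paired with the dual
difference at the right endpoint. The `y` part costs `O(1/L)` per unit time; the `z` part costs `η`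
times the growth of `‖z‖₁`, which telescopes. -/
lemma AveragedFlow.energy_le (hM : M.PosSemidef) (hy : AveragedFlow M r p q L y)
    (hp : ∀ i, 0 ≤ p i) (hq : ∀ i, 0 ≤ q i) (hL : 0 < L) (hS : 0 ≤ S)
    (hB : ∀ s, 0 ≤ s → s ≤ S → ∀ i, |speed (p i) (q i) L (dualVec M r s (y s) i)| ≤ B)
    {η : ℝ} (hη : ∀ s, 0 ≤ s → s ≤ S → ∀ i, |dualVec M r s (y s) i| ≤ 1 + η)
    (hz : ∀ s, 0 ≤ s → ∀ x, scaledLasso M r s (z s) ≤ scaledLasso M r s x) (hz0 : z 0 = 0)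
    (hmono : ∀ i, MonotoneOn (fun s => z s i) (Ici 0) ∨ AntitoneOn (fun s => z s i) (Ici 0)) :
    1 / 2 * dotProduct (y S - z S) (M.mulVec (y S - z S)) ≤
      (∑ i, (p i + q i) / 4) / L * S + η * ∑ i, |z S i| := by
  obtain ⟨K, hK⟩ := hy.exists_increment_le hp hq hL hB
  set C := (∑ i, (p i + q i) / 4) / L
  have h := le_of_increment_le_sq (φ := fun s =>
    1 / 2 * dotProduct (y s - z s) (M.mulVec (y s - z s)) - C * s - η * ∑ i, |z s i|)
    (K := K) hS (fun a b ha hab hb => by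
      have h1 := quadratic_sub_le hM (y a - z a) (y b - z b)
      have e1 : M.mulVec (y b - z b) = dualVec M r b (z b) - dualVec M r b (y b) := by
        simp only [dualVec, Matrix.mulVec_sub]; abel
      have e2 : y b - z b - (y a - z a) = (y b - y a) - (z b - z a) := by abel
      have hb0 := ha.trans hab
      have h2 := hK a b ha hab hb (dualVec M r b (z b)) (abs_dualVec_le_one hM (hz b hb0))
      have h3 : -dotProduct (z b - z a) (dualVec M r b (z b) - dualVec M r b (y b)) ≤
          η * (∑ i, |z b i| - ∑ i, |z a i|) := by
        rw [← Finset.sum_sub_distrib, Finset.mul_sum, dotProduct, ← Finset.sum_neg_distrib]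
        exact Finset.sum_le_sum fun i _ =>
          sub_mul_sub_le_of_monotoneOn (f := fun s => z s i) (by simp [hz0]) (hmono i) ha hab
            (abs_le_dualVec_mul hM (hz b hb0) i) (hη b hb0 hb i)
      have e3 : dotProduct (y b - z b - (y a - z a)) (M.mulVec (y b - z b)) =
          dotProduct (y b - y a) (dualVec M r b (z b) - dualVec M r b (y b)) -
          dotProduct (z b - z a) (dualVec M r b (z b) - dualVec M r b (y b)) := by
        rw [e2, e1, sub_dotProduct]
      rw [e3] at h1
      linarith)
  simp only [hy.init, hz0, sub_self, zero_dotProduct, mul_zero, Pi.zero_apply, abs_zero,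
    Finset.sum_const_zero] at h
  linarith

/-- Chain rule along `y` and an envelope argument along `z`: formally the gap grows at rate `⟨y', c
- w⟩ + ⟨r, z - y⟩` with `c` the sign of `y'`. The first term is `O(1/L)`, the second is bounded by
Young's inequality and the energy. -/
lemma AveragedFlow.scaledLasso_sub_le (hM : M.PosSemidef) (hy : AveragedFlow M r p q L y)
    (hp : ∀ i, 0 ≤ p i) (hq : ∀ i, 0 ≤ q i) (hL : 0 < L) (hS : 0 ≤ S)
    (hB : ∀ s, 0 ≤ s → s ≤ S → ∀ i, |speed (p i) (q i) L (dualVec M r s (y s) i)| ≤ B)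
    {η : ℝ} (hη0 : 0 ≤ η) (hη : ∀ s, 0 ≤ s → s ≤ S → ∀ i, |dualVec M r s (y s) i| ≤ 1 + η)
    (hz : ∀ s, 0 ≤ s → ∀ x, scaledLasso M r s (z s) ≤ scaledLasso M r s x) (hz0 : z 0 = 0)
    (hmono : ∀ i, MonotoneOn (fun s => z s i) (Ici 0) ∨ AntitoneOn (fun s => z s i) (Ici 0))
    {h : ι → ℝ} (hr : M.mulVec h = r) {κ : ℝ} (hκ : 0 < κ) :
    scaledLasso M r S (y S) - scaledLasso M r S (z S) ≤
      (∑ i, (p i + q i) / 4) / L * S + (κ / 2 * dotProduct h (M.mulVec h) +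
        ((∑ i, (p i + q i) / 4) / L * S + η * ∑ i, |z S i|) / κ) * S := by
  obtain ⟨K, hK⟩ := hy.exists_increment_le hp hq hL hB
  have hC : 0 ≤ (∑ i, (p i + q i) / 4) / L :=
    div_nonneg (Finset.sum_nonneg fun i _ => by linarith [hp i, hq i]) hL.le
  have hgap : ∀ b, 0 ≤ b → b ≤ S → dotProduct r (z b - y b) ≤
      κ / 2 * dotProduct h (M.mulVec h) +
        ((∑ i, (p i + q i) / 4) / L * S + η * ∑ i, |z S i|) / κ := by
    intro b hb0 hb
    have h1' := dotProduct_mulVec_le_young hM h (z b - y b) hκ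
    have h2 := hy.energy_le hM hp hq hL hb0 (fun s h0 h1 => hB s h0 (h1.trans hb))
      (fun s h0 h1 => hη s h0 (h1.trans hb)) hz hz0 hmono
    rw [← neg_sub (y b) (z b), Matrix.mulVec_neg, neg_dotProduct_neg, dotProduct_neg] at h1'
    rw [← neg_sub (y b) (z b), dotProduct_neg, ← hr, dotProduct_comm,
      dotProduct_mulVec_comm_of_isSymm (isSymm_of_posSemidef hM), hr]
    have h4 : ∑ i, |z b i| ≤ ∑ i, |z S i| := Finset.sum_le_sum fun i _ =>
      abs_le_abs_of_monotoneOn (f := fun s => z s i) (by simp [hz0]) (hmono i) hb0 hb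
    have h5 : 1 / 2 * dotProduct (y b - z b) (M.mulVec (y b - z b)) ≤
        (∑ i, (p i + q i) / 4) / L * S + η * ∑ i, |z S i| := h2.trans (by gcongr)
    rw [← hr]
    refine h1'.trans ?_
    gcongr
  set C := (∑ i, (p i + q i) / 4) / L
  set ρ := κ / 2 * dotProduct h (M.mulVec h) + (C * S + η * ∑ i, |z S i|) / κ
  have h := le_of_increment_le_sq (φ := fun s =>
    scaledLasso M r s (y s) - scaledLasso M r s (z s) - C * s - ρ * s)
    (K := K + ∑ i, |r i| * B) hS (fun a b ha hab hb => by
      have hb0 := ha.trans hab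
      have h1 := quadratic_sub_le hM (y a) (y b)
      set c : ι → ℝ := fun i => if 0 ≤ y b i - y a i then 1 else -1 with hc
      have h2 := hK a b ha hab hb c (fun i => by rw [hc]; dsimp only; split_ifs <;> simp)
      have h3 : ∑ i, |y b i| - ∑ i, |y a i| ≤ dotProduct (y b - y a) c := by
        rw [← Finset.sum_sub_distrib]
        refine Finset.sum_le_sum fun i _ => (abs_sub_abs_le_abs_sub _ _).trans (le_of_eq ?_)
        simp only [hc, Pi.sub_apply]
        split_ifs with h0
        · rw [abs_of_nonneg h0, mul_one]
        · rw [abs_of_neg (not_le.1 h0)]; ring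
      have h4 : dotProduct r (y b - y a) ≤ (∑ i, |r i| * B) * (b - a) := by
        rw [Finset.sum_mul]
        refine Finset.sum_le_sum fun i _ => (le_abs_self _).trans ?_
        rw [abs_mul, mul_assoc]
        exact mul_le_mul_of_nonneg_left (hy.abs_sub_le hB ha hab hb i) (abs_nonneg _)
      have h5 := mul_le_mul_of_nonneg_left h4 (sub_nonneg.2 hab)
      have h6 := mul_le_mul_of_nonneg_left (hgap b hb0 hb) (sub_nonneg.2 hab)
      -- Envelope step: with `z b` as competitor at time `a`, the optimal value changes by at least
      -- `-(b - a) ⟨r, z b⟩`.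
      have h7 := hz a ha (z b)
      have e1 := dotProduct_comm (y b - y a) r
      simp only [dualVec, scaledLasso, dotProduct_sub, sub_dotProduct, dotProduct_smul,
        smul_eq_mul] at *
      nlinarith)
  simp only [hy.init, hz0, sub_self, mul_zero, scaledLasso] at h
  rw [scaledLasso, scaledLasso]
  linarith

end Flow

/-! ### Gradients of the loss -/

section Gradient

variable {d : ℕ} {M : Matrix (Fin d) (Fin d) ℝ} {r : EuclideanSpace ℝ (Fin d)}

lemma inner_eq_dotProduct_ofLp (a b : EuclideanSpace ℝ (Fin d)) :
    ⟪a, b⟫ = dotProduct a.ofLp b.ofLp := by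
  rw [EuclideanSpace.inner_eq_star_dotProduct, dotProduct_comm]; simp

lemma loss_eq (x : EuclideanSpace ℝ (Fin d)) : loss M r x =
    1 / 2 * dotProduct x.ofLp (M.mulVec x.ofLp) - dotProduct r.ofLp x.ofLp := by
  rw [loss, inner_eq_dotProduct_ofLp, inner_eq_dotProduct_ofLp]
  rfl

lemma hadamard_comm (a b : EuclideanSpace ℝ (Fin d)) : hadamard a b = hadamard b a := by
  ext i; simp [hadamard, mul_comm]

lemma hasGradientAt_loss (hM : M.PosSemidef) (x : EuclideanSpace ℝ (Fin d)) :
    HasGradientAt (loss M r) (Matrix.toEuclideanLin M x - r) x := by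
  rw [hasGradientAt_iff_hasFDerivAt]
  have h1 : HasFDerivAt (fun x => Matrix.toEuclideanLin M x)
    (LinearMap.toContinuousLinearMap (Matrix.toEuclideanLin M)) x :=
    (LinearMap.toContinuousLinearMap (Matrix.toEuclideanLin M)).hasFDerivAt
  have h2 := (((hasFDerivAt_id x).inner ℝ h1).const_mul (1 / 2 : ℝ)).sub
    ((hasFDerivAt_const r x).inner ℝ (hasFDerivAt_id x))
  refine h2.congr_fderiv ?_
  ext k
  have h3 := dotProduct_mulVec_comm_of_isSymm (isSymm_of_posSemidef hM) x.ofLp k.ofLp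
  have h4 : ⟪x, Matrix.toEuclideanLin M k⟫ = ⟪Matrix.toEuclideanLin M x, k⟫ := by
    rw [inner_eq_dotProduct_ofLp, inner_eq_dotProduct_ofLp, dotProduct_comm _ k.ofLp]
    exact h3
  simp [h4, real_inner_comm (Matrix.toEuclideanLin M x) k]
  ring

lemma gradient_loss_hadamard (hM : M.PosSemidef) (u v : EuclideanSpace ℝ (Fin d)) :
    gradient (fun a => loss M r (hadamard a v)) u =
      hadamard v (Matrix.toEuclideanLin M (hadamard u v) - r) := by
  apply HasGradientAt.gradient
  let T : EuclideanSpace ℝ (Fin d) →ₗ[ℝ] EuclideanSpace ℝ (Fin d) :=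
    { toFun := fun a => hadamard a v
      map_add' := fun a b => by ext i; simp [hadamard, add_mul]
      map_smul' := fun c a => by ext i; simp [hadamard, mul_assoc] }
  have h1 : HasFDerivAt (fun a => hadamard a v) (LinearMap.toContinuousLinearMap T) u :=
    (LinearMap.toContinuousLinearMap T).hasFDerivAt
  rw [hasGradientAt_iff_hasFDerivAt]
  refine ((hasGradientAt_loss hM (r := r) (hadamard u v)).hasFDerivAt.comp u h1).congr_fderiv ?_
  ext k
  have : (LinearMap.toContinuousLinearMap T) k = hadamard k v := rfl
  simp only [ContinuousLinearMap.comp_apply, this, InnerProductSpace.toDual_apply_apply,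
    inner_eq_dotProduct_ofLp, dotProduct]
  refine Finset.sum_congr rfl fun i _ => ?_
  simp only [hadamard]
  ring

end Gradient

lemma hasDerivWithinAt_integral_Ici {E : Type*} [NormedAddCommGroup E] [NormedSpace ℝ E]
    [CompleteSpace E] {f : ℝ → E} (hf : ContinuousOn f (Ici 0)) {t : ℝ} (ht : 0 ≤ t) :
    HasDerivWithinAt (fun t => ∫ τ in (0 : ℝ)..t, f τ) (f t) (Ici 0) t := by
  -- `f` is controlled only on `[0, ∞)`; composing with `max · 0` extends it continuously without
  -- changing these integrals.
  have hc : Continuous fun t => f (max t 0) :=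
    hf.comp_continuous (by fun_prop) fun t => le_max_right t 0
  have h1 := (hc.integral_hasStrictDerivAt 0 t).hasDerivAt.hasDerivWithinAt (s := Ici 0)
  have heq : ∀ t ∈ Ici (0 : ℝ), ∫ τ in (0 : ℝ)..t, f τ = ∫ τ in (0 : ℝ)..t, f (max τ 0) := by
    intro t ht
    refine intervalIntegral.integral_congr fun τ hτ => ?_
    rw [uIcc_of_le ht] at hτ
    simp [max_eq_left hτ.1]
  simp only [max_eq_left ht] at h1
  exact h1.congr heq (heq t ht)

/-! ### Solving the gradient flow in rescaled time -/

section Flow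

variable {d : ℕ} {M : Matrix (Fin d) (Fin d) ℝ} {r u₀ v₀ : EuclideanSpace ℝ (Fin d)}
  {u v : ℝ → EuclideanSpace ℝ (Fin d)}

lemma hasDerivWithinAt_coord {f : ℝ → EuclideanSpace ℝ (Fin d)} {f' : EuclideanSpace ℝ (Fin d)}
    {s : Set ℝ} {t : ℝ} (h : HasDerivWithinAt f f' s t) (i : Fin d) :
    HasDerivWithinAt (fun t => f t i) (f' i) s t :=
  (EuclideanSpace.proj (𝕜 := ℝ) i).hasFDerivAt.comp_hasDerivWithinAt t h

lemma IsGradientFlow.hasDerivWithinAt_u (hM : M.PosSemidef) (h : IsGradientFlow M r u₀ v₀ u v)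
    {t : ℝ} (ht : 0 ≤ t) (i : Fin d) : HasDerivWithinAt (fun t => u t i)
      (-(v t i * (M.mulVec (hadamard (u t) (v t)).ofLp i - r i))) (Ici 0) t := by
  have h1 := h.deriv_u t ht
  rw [gradient_loss_hadamard hM] at h1
  exact hasDerivWithinAt_coord h1 i

lemma IsGradientFlow.hasDerivWithinAt_v (hM : M.PosSemidef) (h : IsGradientFlow M r u₀ v₀ u v)
    {t : ℝ} (ht : 0 ≤ t) (i : Fin d) : HasDerivWithinAt (fun t => v t i)
      (-(u t i * (M.mulVec (hadamard (u t) (v t)).ofLp i - r i))) (Ici 0) t := by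
  have h1 := h.deriv_v t ht
  simp only [hadamard_comm (u t)] at h1
  rw [gradient_loss_hadamard hM, hadamard_comm (v t) (u t)] at h1
  exact hasDerivWithinAt_coord h1 i

lemma IsGradientFlow.continuousOn_hadamard (h : IsGradientFlow M r u₀ v₀ u v) :
    ContinuousOn (fun t => hadamard (u t) (v t)) (Ici 0) := by
  have hu : ContinuousOn u (Ici 0) := fun t ht => (h.deriv_u t ht).continuousWithinAt
  have hv : ContinuousOn v (Ici 0) := fun t ht => (h.deriv_v t ht).continuousWithinAt
  unfold hadamard
  fun_prop

/-- Integrating factor: `a * exp G` has zero derivative. -/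
lemma eq_mul_exp_of_hasDerivWithinAt {a g G : ℝ → ℝ} (hG0 : G 0 = 0)
    (ha : ∀ t, 0 ≤ t → HasDerivWithinAt a (-(a t * g t)) (Ici 0) t)
    (hG : ∀ t, 0 ≤ t → HasDerivWithinAt G (g t) (Ici 0) t) {t : ℝ} (ht : 0 ≤ t) :
    a t = a 0 * Real.exp (-G t) := by
  have h := abs_sub_le_mul_of_hasDerivWithinAt_Ici (f := fun t => a t * Real.exp (G t))
    (C := 0) le_rfl ht (fun t h0 _ => (ha t h0).mul (hG t h0).exp) (fun t _ _ => by
      rw [show -(a t * g t) * Real.exp (G t) + a t * (Real.exp (G t) * g t) = 0 by ring]; simp)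
  rw [zero_mul, abs_nonpos_iff, hG0, Real.exp_zero, mul_one, sub_eq_zero] at h
  rw [← h, mul_assoc, ← Real.exp_add]
  simp

/-- The squared norm has derivative `-4 ⟨x, M x - r⟩`, bounded above because `r = M c`. Growth is
thus linear in time, which at times of order `L` gives the velocity bound `O(L)`. -/
lemma IsGradientFlow.sq_sum_le (hM : M.PosSemidef) (h : IsGradientFlow M r u₀ v₀ u v)
    {c : Fin d → ℝ} (hc : M.mulVec c = r.ofLp) {t : ℝ} (ht : 0 ≤ t) :
    ∑ i, (u t i ^ 2 + v t i ^ 2) ≤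
      ∑ i, (u₀ i ^ 2 + v₀ i ^ 2) + dotProduct c (M.mulVec c) * t := by
  have h1 := sub_le_mul_of_hasDerivWithinAt_Ici (f := fun t => ∑ i, (u t i ^ 2 + v t i ^ 2))
    (C := dotProduct c (M.mulVec c)) le_rfl ht (fun t h0 _ => HasDerivWithinAt.fun_sum fun i _ =>
      ((h.hasDerivWithinAt_u hM h0 i).pow 2).add ((h.hasDerivWithinAt_v hM h0 i).pow 2))
    (fun t h0 _ => by
      set x := hadamard (u t) (v t) with hx
      -- `κ = 1/2` makes the quadratic term in `x` cancel exactly.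
      have h2 := dotProduct_mulVec_le_young hM c x.ofLp (κ := 1 / 2) (by norm_num)
      have h3 : dotProduct c (M.mulVec x.ofLp) = dotProduct x.ofLp r.ofLp := by
        rw [dotProduct_mulVec_comm_of_isSymm (isSymm_of_posSemidef hM), hc]
      refine le_of_eq_of_le (b := -4 * (dotProduct x.ofLp (M.mulVec x.ofLp) -
        dotProduct x.ofLp r.ofLp)) ?_ (by rw [← h3]; linarith)
      rw [← dotProduct_sub, dotProduct, Finset.mul_sum]
      refine Finset.sum_congr rfl fun i _ => ?_
      simp only [hx, hadamard, Pi.sub_apply]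
      push_cast
      ring)
  simp only [h.init_u, h.init_v] at h1
  linarith

/-- The integrated trajectory in rescaled time. -/
noncomputable def rescaledIntegral (u v : ℝ → EuclideanSpace ℝ (Fin d)) (L s : ℝ) : Fin d → ℝ :=
  fun i => 2 / L * (∫ τ in (0 : ℝ)..(L / 2 * s), hadamard (u τ) (v τ)) i

/-- `4 u v = (u + v)² - (u - v)²`, and both squares are explicit exponentials of the integrated
gradient `G`, which at time `L s / 2` equals `-L w / 2`. The initial scale `√ε = exp(-L/2)` supplies
the `1` in `1 ± w`. -/
lemma IsGradientFlow.hadamard_eq_speed {β γ : EuclideanSpace ℝ (Fin d)} {L : ℝ}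
    (hM : M.PosSemidef)
    (h : IsGradientFlow M r (√(Real.exp (-L)) • β) (√(Real.exp (-L)) • γ) u v) (hL : 0 < L)
    {s : ℝ} (hs : 0 ≤ s) (i : Fin d) :
    hadamard (u (L / 2 * s)) (v (L / 2 * s)) i =
      speed ((β i + γ i) ^ 2) ((β i - γ i) ^ 2) L
        (dualVec M r.ofLp s (rescaledIntegral u v L s) i) := by
  set X : ℝ → EuclideanSpace ℝ (Fin d) := fun t => ∫ τ in (0 : ℝ)..t, hadamard (u τ) (v τ)
    with hX
  set g : ℝ → ℝ := fun t => M.mulVec (hadamard (u t) (v t)).ofLp i - r i with hg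
  set G : ℝ → ℝ := fun t => M.mulVec (X t).ofLp i - t * r i with hG
  have hGd : ∀ t, 0 ≤ t → HasDerivWithinAt G (g t) (Ici 0) t := by
    intro t ht
    have h1 := hasDerivWithinAt_integral_Ici h.continuousOn_hadamard ht
    have h2 : HasDerivWithinAt (fun t => M.mulVec (X t).ofLp i)
        (M.mulVec (hadamard (u t) (v t)).ofLp i) (Ici 0) t := by
      simp only [Matrix.mulVec, dotProduct]
      exact HasDerivWithinAt.fun_sum fun j _ => (hasDerivWithinAt_coord h1 j).const_mul _
    have h3 := h2.sub ((hasDerivWithinAt_id t (Ici 0)).mul_const (r i))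
    exact h3.congr_deriv (by simp [hg])
  have hG0 : G 0 = 0 := by simp [hG, hX]
  have ht : 0 ≤ L / 2 * s := by positivity
  have ha := eq_mul_exp_of_hasDerivWithinAt (a := fun t => u t i + v t i) hG0 (fun t ht => by
    have := (h.hasDerivWithinAt_u hM ht i).add (h.hasDerivWithinAt_v hM ht i)
    refine this.congr_deriv ?_
    simp only [hg]; ring) hGd ht
  have hb := eq_mul_exp_of_hasDerivWithinAt (a := fun t => u t i - v t i) (g := fun t => - g t)
    (G := fun t => - G t) (by simp [hG0]) (fun t ht => by
    have := (h.hasDerivWithinAt_u hM ht i).sub (h.hasDerivWithinAt_v hM ht i)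
    refine this.congr_deriv ?_
    simp only [hg]; ring) (fun t ht => (hGd t ht).neg) ht
  set w := dualVec M r.ofLp s (rescaledIntegral u v L s) i with hw
  have hGw : G (L / 2 * s) = -(L / 2 * w) := by
    have e : rescaledIntegral u v L s = (2 / L) • (X (L / 2 * s)).ofLp := rfl
    simp only [hw, hG, dualVec, e, Matrix.mulVec_smul, Pi.sub_apply, Pi.smul_apply, smul_eq_mul]
    field_simp
    ring
  have hsq : √(Real.exp (-L)) = Real.exp (-(L / 2)) := by
    rw [Real.sqrt_eq_iff_eq_sq (Real.exp_pos _).le (Real.exp_pos _).le, ← Real.exp_nat_mul]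
    congr 1; push_cast; ring
  simp only [h.init_u, h.init_v, hsq, hGw, PiLp.smul_apply, smul_eq_mul, neg_neg] at ha hb
  have ha' : u (L / 2 * s) i + v (L / 2 * s) i =
      (β i + γ i) * Real.exp (-(L * (1 - w)) / 2) := by
    rw [ha, ← mul_add, mul_comm (Real.exp _), mul_assoc, ← Real.exp_add]
    ring_nf
  have hb' : u (L / 2 * s) i - v (L / 2 * s) i =
      (β i - γ i) * Real.exp (-(L * (1 + w)) / 2) := by
    rw [hb, ← mul_sub, mul_comm (Real.exp _), mul_assoc, ← Real.exp_add]
    ring_nf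
  have hexp : ∀ z : ℝ, Real.exp z = Real.exp (z / 2) ^ 2 := by
    intro z
    rw [← Real.exp_nat_mul]; congr 1; push_cast; ring
  rw [speed, hexp (-(L * (1 - w))), hexp (-(L * (1 + w))), ← mul_pow, ← mul_pow, ← ha', ← hb']
  simp only [hadamard]
  ring

lemma IsGradientFlow.averagedFlow {β γ : EuclideanSpace ℝ (Fin d)} {L : ℝ} (hM : M.PosSemidef)
    (h : IsGradientFlow M r (√(Real.exp (-L)) • β) (√(Real.exp (-L)) • γ) u v) (hL : 0 < L) :
    AveragedFlow M r.ofLp (fun i => (β i + γ i) ^ 2) (fun i => (β i - γ i) ^ 2) L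
      (rescaledIntegral u v L) where
  init := by funext i; simp [rescaledIntegral]
  deriv s hs i := by
    rw [← h.hadamard_eq_speed hM hL hs i]
    have ht : 0 ≤ L / 2 * s := by positivity
    have h1 := hasDerivWithinAt_coord
      (hasDerivWithinAt_integral_Ici h.continuousOn_hadamard ht) i
    have h2 : HasDerivWithinAt (fun s => L / 2 * s) (L / 2) (Ici 0) s := by
      simpa using (hasDerivWithinAt_id s (Ici 0)).const_mul (L / 2)
    have h3 := (h1.comp s h2 (fun τ (hτ : 0 ≤ τ) => mem_Ici.2 (by positivity))).const_mul (2 / L)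
    refine h3.congr_deriv ?_
    field_simp

lemma IsGradientFlow.abs_speed_le {β γ : EuclideanSpace ℝ (Fin d)} {L S : ℝ} (hM : M.PosSemidef)
    (h : IsGradientFlow M r (√(Real.exp (-L)) • β) (√(Real.exp (-L)) • γ) u v) (hL : 1 ≤ L)
    {c : Fin d → ℝ} (hc : M.mulVec c = r.ofLp) {s : ℝ} (hs : 0 ≤ s) (hsS : s ≤ S) (i : Fin d) :
    |speed ((β i + γ i) ^ 2) ((β i - γ i) ^ 2) L
        (dualVec M r.ofLp s (rescaledIntegral u v L s) i)| ≤
      (∑ i, (β i ^ 2 + γ i ^ 2) + dotProduct c (M.mulVec c) * S) * L := by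
  rw [← h.hadamard_eq_speed hM (by linarith) hs i]
  have ht : 0 ≤ L / 2 * s := by positivity
  have h1 := h.sq_sum_le hM hc ht
  have h2 := Finset.single_le_sum
    (f := fun i => u (L / 2 * s) i ^ 2 + v (L / 2 * s) i ^ 2) (fun j _ => by positivity)
    (Finset.mem_univ i)
  have h3 : ∑ i, ((√(Real.exp (-L)) • β) i ^ 2 + (√(Real.exp (-L)) • γ) i ^ 2) ≤
      (∑ i, (β i ^ 2 + γ i ^ 2)) * L := by
    rw [Finset.sum_mul]
    refine Finset.sum_le_sum fun j _ => ?_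
    simp only [PiLp.smul_apply, smul_eq_mul, mul_pow, Real.sq_sqrt (Real.exp_pos _).le]
    have : Real.exp (-L) ≤ L := (Real.exp_le_one_iff.2 (by linarith)).trans hL
    rw [← mul_add, mul_comm]
    gcongr
  have h4 : dotProduct c (M.mulVec c) * (L / 2 * s) ≤ dotProduct c (M.mulVec c) * S * L := by
    rw [mul_assoc]
    refine mul_le_mul_of_nonneg_left ?_ (dotProduct_mulVec_self_nonneg hM c)
    nlinarith
  have h5 : |hadamard (u (L / 2 * s)) (v (L / 2 * s)) i| ≤
      u (L / 2 * s) i ^ 2 + v (L / 2 * s) i ^ 2 := by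
    simp only [hadamard]
    rw [abs_le]
    constructor <;> nlinarith [sq_nonneg (u (L / 2 * s) i - v (L / 2 * s) i),
      sq_nonneg (u (L / 2 * s) i + v (L / 2 * s) i)]
  dsimp only at h2
  linarith

end Flow

/-! ### Return to the lasso objective and rates in `L` -/

section Conclusion

variable {d : ℕ} {M : Matrix (Fin d) (Fin d) ℝ} {r : EuclideanSpace ℝ (Fin d)}

lemma scaledLasso_smul (x : EuclideanSpace ℝ (Fin d)) {s : ℝ} (hs : 0 < s) :
    scaledLasso M r.ofLp s (s • x.ofLp) = s ^ 2 * lasso M r x (1 / s) := by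
  simp only [scaledLasso, lasso, loss_eq, Matrix.mulVec_smul, dotProduct_smul, smul_dotProduct,
    Pi.smul_apply, smul_eq_mul, abs_mul, abs_of_pos hs, ← Finset.mul_sum]
  field_simp

lemma scaledLasso_path_le (hM : M.PosSemidef) {x : ℝ → EuclideanSpace ℝ (Fin d)}
    (hx : ∀ s : ℝ, 0 < s → IsMinOn (fun z => lasso M r z (1 / s)) univ (x s)) {s : ℝ}
    (hs : 0 ≤ s) (y : Fin d → ℝ) :
    scaledLasso M r.ofLp s (s • (x s).ofLp) ≤ scaledLasso M r.ofLp s y := by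
  rcases hs.eq_or_lt with rfl | hs
  · have := dotProduct_mulVec_self_nonneg hM y
    have h2 : 0 ≤ ∑ i, |y i| := Finset.sum_nonneg fun i _ => abs_nonneg _
    simp [scaledLasso]
    linarith
  · have h1 : y = s • (WithLp.toLp 2 (s⁻¹ • y) : EuclideanSpace ℝ (Fin d)).ofLp := by
      simp [smul_smul, hs.ne']
    rw [h1, scaledLasso_smul _ hs, scaledLasso_smul _ hs]
    gcongr
    exact hx s hs (mem_univ _)

lemma monotone_path_Ici (hM : M.PosSemidef) {x : ℝ → EuclideanSpace ℝ (Fin d)}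
    (hx : ∀ s : ℝ, 0 < s → IsMinOn (fun z => lasso M r z (1 / s)) univ (x s))
    (hmono : ∀ i, MonotoneOn (fun s : ℝ => s * x s i) (Ioi 0) ∨
      AntitoneOn (fun s : ℝ => s * x s i) (Ioi 0)) (i : Fin d) :
    MonotoneOn (fun s => (s • (x s).ofLp) i) (Ici 0) ∨
      AntitoneOn (fun s => (s • (x s).ofLp) i) (Ici 0) := by
  have hsmall : ∀ s : ℝ, 0 < s → ∃ t, 0 < t ∧ t ≤ s ∧ t * x t i = 0 := by
    intro s hs
    have hR : 0 ≤ ∑ i, |r i| := Finset.sum_nonneg fun i _ => abs_nonneg _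
    have ht : 0 < min s (1 / (∑ i, |r i| + 1)) := by positivity
    refine ⟨_, ht, min_le_left _ _, ?_⟩
    refine congrFun (eq_zero_of_isMin_of_small hM (scaledLasso_path_le hM hx ht.le) ht.le ?_) i
    calc _ ≤ 1 / (∑ i, |r i| + 1) * ∑ i, |r i| := by gcongr; exact min_le_right _ _
      _ < 1 := by rw [one_div_mul_eq_div, div_lt_one (by positivity)]; linarith
  simp only [Pi.smul_apply, smul_eq_mul]
  refine (hmono i).imp (fun h a ha b hb hab => ?_) (fun h a ha b hb hab => ?_) <;>
  · rcases (mem_Ici.1 ha).eq_or_lt with rfl | ha'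
    · rcases (mem_Ici.1 hb).eq_or_lt with rfl | hb'
      · simp
      · obtain ⟨t, ht, htb, h0⟩ := hsmall b hb'
        have := h ht hb' htb
        simp only [h0] at this
        simpa using this
    · exact h ha' (ha'.trans_le hab) hab

lemma lassoMin_eq {lam : ℝ} {x : EuclideanSpace ℝ (Fin d)}
    (hx : IsMinOn (fun z => lasso M r z lam) univ x) : lassoMin M r lam = lasso M r x lam :=
  le_antisymm (ciInf_le ⟨lasso M r x lam, by rintro _ ⟨z, rfl⟩; exact hx (mem_univ z)⟩ x)
    (le_ciInf fun z => hx (mem_univ z))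

lemma smul_timeAverage (u v : ℝ → EuclideanSpace ℝ (Fin d)) {ε s : ℝ} (hs : 0 < s)
    (hL : 0 < Real.log (1 / ε)) :
    s • (timeAverage (fun t => hadamard (u t) (v t)) (originalTime ε s)).ofLp =
      rescaledIntegral u v (Real.log (1 / ε)) s := by
  funext i
  simp only [timeAverage, originalTime, rescaledIntegral, Pi.smul_apply, smul_eq_mul,
    PiLp.smul_apply]
  field_simp

/-- The optimality gap of the averaged flow is of order `L ^ (-1/4)` with `L = log (1 / ε)`. -/
lemma exists_scaledLasso_sub_le (hM : M.PosSemidef)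
    (hr : r ∈ LinearMap.range (Matrix.toEuclideanLin M)) {β γ : EuclideanSpace ℝ (Fin d)}
    (hβγ : ∀ i, β i ≠ γ i ∧ β i ≠ -γ i) {z : ℝ → Fin d → ℝ}
    (hz : ∀ s, 0 ≤ s → ∀ x, scaledLasso M r.ofLp s (z s) ≤ scaledLasso M r.ofLp s x)
    (hz0 : z 0 = 0)
    (hmono : ∀ i, MonotoneOn (fun s => z s i) (Ici 0) ∨ AntitoneOn (fun s => z s i) (Ici 0))
    {S : ℝ} (hS : 0 ≤ S) :
    ∃ A, ∀ (L : ℝ) (u v : ℝ → EuclideanSpace ℝ (Fin d)), 1 ≤ L →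
      IsGradientFlow M r (√(Real.exp (-L)) • β) (√(Real.exp (-L)) • γ) u v →
      scaledLasso M r.ofLp S (rescaledIntegral u v L S) - scaledLasso M r.ofLp S (z S) ≤
        A * √(√(1 / L)) := by
  obtain ⟨c, hc⟩ := hr
  replace hc : M.mulVec c.ofLp = r.ofLp := by rw [← hc]; rfl
  set p : Fin d → ℝ := fun i => (β i + γ i) ^ 2 with hp
  set q : Fin d → ℝ := fun i => (β i - γ i) ^ 2 with hq
  have hp0 : ∀ i, 0 < p i := fun i => by
    have : β i + γ i ≠ 0 := fun h => (hβγ i).2 (by linarith)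
    positivity
  have hq0 : ∀ i, 0 < q i := fun i => by
    have : β i - γ i ≠ 0 := sub_ne_zero.2 (hβγ i).1
    positivity
  obtain ⟨m, hm, hmin⟩ : ∃ m, 0 < m ∧ ∀ i, m ≤ p i ∧ m ≤ q i := by
    rcases isEmpty_or_nonempty (Fin d) with h | h
    · exact ⟨1, one_pos, fun i => h.elim i⟩
    · obtain ⟨j, hj⟩ := Finite.exists_min fun i => min (p i) (q i)
      exact ⟨min (p j) (q j), lt_min (hp0 j) (hq0 j), fun i => le_min_iff.1 (hj i)⟩
  set Q := ∑ i, (p i + q i) with hQ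
  have hmax : ∀ i, p i ≤ Q ∧ q i ≤ Q := fun i => by
    have := Finset.single_le_sum (f := fun i => p i + q i)
      (fun j _ => (add_pos (hp0 j) (hq0 j)).le) (Finset.mem_univ i)
    constructor <;> linarith [hp0 i, hq0 i]
  have hQ0 : 0 ≤ Q := Finset.sum_nonneg fun i _ => (add_pos (hp0 i) (hq0 i)).le
  set H := dotProduct c.ofLp (M.mulVec c.ofLp) with hH
  have hH0 : 0 ≤ H := dotProduct_mulVec_self_nonneg hM _
  set B := ∑ i, (β i ^ 2 + γ i ^ 2) + H * S with hB
  have hB0 : 0 ≤ B := by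
    have : 0 ≤ ∑ i, (β i ^ 2 + γ i ^ 2) := Finset.sum_nonneg fun i _ => by positivity
    positivity
  set C := ∑ i, (p i + q i) / 4 with hC
  have hC0 : 0 ≤ C := Finset.sum_nonneg fun i _ => by linarith [hp0 i, hq0 i]
  set Z := ∑ i, |z S i| with hZ
  have hZ0 : 0 ≤ Z := Finset.sum_nonneg fun i _ => abs_nonneg _
  set N := √(2 * (4 * B + Q) / m) with hN
  refine ⟨C * S + (H / 2 + (C * S + N * Z)) * S, fun L u v hL hflow => ?_⟩
  have hL0 : 0 < L := one_pos.trans_le hL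
  -- `κ = L^(-1/4)` balances `κ H / 2` against the energy bound, of order `κ²`, divided by `κ`.
  set κ := √(√(1 / L)) with hκ
  have hκ0 : 0 < κ := by positivity
  have hκ2 : κ ^ 2 = √(1 / L) := Real.sq_sqrt (by positivity)
  have hκ4 : (κ ^ 2) ^ 2 = 1 / L := by rw [hκ2]; exact Real.sq_sqrt (by positivity)
  have hκ1 : κ ≤ 1 := by
    have h : 1 / L ≤ 1 := (div_le_one hL0).2 hL
    exact Real.sqrt_le_one.2 (Real.sqrt_le_one.2 h)
  have hη : √(2 * (4 * (B * L) + Q) / m) / L ≤ N * κ ^ 2 := by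
    have h1 : √(2 * (4 * (B * L) + Q) / m) ≤ √(2 * (4 * B + Q) / m * L) := by
      apply Real.sqrt_le_sqrt
      rw [div_mul_eq_mul_div, mul_assoc]
      gcongr
      nlinarith
    rw [Real.sqrt_mul (by positivity)] at h1
    rw [div_le_iff₀ hL0]
    refine h1.trans (le_of_eq ?_)
    have h2 : √L = κ ^ 2 * L := by
      rw [hκ2, Real.sqrt_div zero_le_one, Real.sqrt_one, div_mul_eq_mul_div, one_mul,
        Real.div_sqrt]
    rw [h2, hN]; ring
  have hsp : ∀ s, 0 ≤ s → s ≤ S → ∀ i,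
      |speed (p i) (q i) L (dualVec M r.ofLp s (rescaledIntegral u v L s) i)| ≤ B * L :=
    fun s hs hsS i => hflow.abs_speed_le hM hL hc hs hsS i
  have h1 := (hflow.averagedFlow hM hL0).scaledLasso_sub_le hM (fun i => (hp0 i).le)
    (fun i => (hq0 i).le) hL0 hS hsp (η := N * κ ^ 2) (by positivity)
    (fun s hs hsS i => (abs_le_one_add_of_abs_speed_le hm (hmin i).1 (hmin i).2 (hmax i).1
      (hmax i).2 hL0 (hsp s hs hsS i)).trans (by linarith)) hz hz0 hmono hc hκ0
  change _ ≤ C / L * S + (κ / 2 * H + (C / L * S + N * κ ^ 2 * Z) / κ) * S at h1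
  refine h1.trans ?_
  have h2 : C / L = C * κ ^ 4 := by
    rw [div_eq_mul_one_div, ← hκ4]; ring
  have h3 : (C / L * S + N * κ ^ 2 * Z) / κ = C * S * κ ^ 3 + N * Z * κ := by
    rw [h2]; field_simp
  rw [h3, h2]
  have h4 : κ ^ 4 ≤ κ := by simpa using pow_le_pow_of_le_one hκ0.le hκ1 (show 1 ≤ 4 by norm_num)
  have h5 : κ ^ 3 ≤ κ := by simpa using pow_le_pow_of_le_one hκ0.le hκ1 (show 1 ≤ 3 by norm_num)
  calc C * κ ^ 4 * S + (κ / 2 * H + (C * S * κ ^ 3 + N * Z * κ)) * S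
      ≤ C * κ * S + (κ / 2 * H + (C * S * κ + N * Z * κ)) * S := by gcongr
    _ = _ := by ring

end Conclusion

end DLN

theorem theorem1 (d : ℕ) (M : Matrix (Fin d) (Fin d) ℝ) (hM : M.PosSemidef)
    (r : EuclideanSpace ℝ (Fin d)) (hr : r ∈ LinearMap.range (Matrix.toEuclideanLin M))
    (β γ : EuclideanSpace ℝ (Fin d)) (hβγ : ∀ i, β i ≠ γ i ∧ β i ≠ -γ i)
    (u v : ℝ → ℝ → EuclideanSpace ℝ (Fin d))
    (huv : ∀ ε : ℝ, 0 < ε →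
      DLN.IsGradientFlow M r (Real.sqrt ε • β) (Real.sqrt ε • γ) (u ε) (v ε))
    (x : ℝ → EuclideanSpace ℝ (Fin d))
    (hx : ∀ s : ℝ, 0 < s → IsMinOn (fun z => DLN.lasso M r z (1 / s)) univ (x s))
    (hmono : ∀ i, MonotoneOn (fun s : ℝ => s * x s i) (Ioi 0) ∨
      AntitoneOn (fun s : ℝ => s * x s i) (Ioi 0))
    (s : ℝ) (hs : 0 < s) :
    Tendsto
      (fun ε : ℝ => DLN.lasso M r
        (DLN.timeAverage (fun t => DLN.hadamard (u ε t) (v ε t)) (DLN.originalTime ε s)) (1 / s))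
      (𝓝[>] 0) (𝓝 (DLN.lassoMin M r (1 / s))) := by
  rw [DLN.lassoMin_eq (hx s hs)]
  obtain ⟨A, hA⟩ := DLN.exists_scaledLasso_sub_le hM hr hβγ
    (fun s hs => DLN.scaledLasso_path_le hM hx hs) (by simp) (DLN.monotone_path_Ici hM hx hmono)
    hs.le
  have hlog : Tendsto (fun ε : ℝ => Real.log (1 / ε)) (𝓝[>] 0) atTop := by
    simp only [one_div]
    exact Real.tendsto_log_atTop.comp tendsto_inv_nhdsGT_zero
  have hgap : Tendsto (fun ε : ℝ => DLN.lasso M r (x s) (1 / s) +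
      A * √(√(1 / Real.log (1 / ε))) / s ^ 2) (𝓝[>] 0) (𝓝 (DLN.lasso M r (x s) (1 / s))) := by
    have h1 : Tendsto (fun ε : ℝ => 1 / Real.log (1 / ε)) (𝓝[>] 0) (𝓝 0) :=
      hlog.const_div_atTop 1
    have h2 := ((h1.sqrt.sqrt.const_mul A).div_const (s ^ 2)).const_add
      (DLN.lasso M r (x s) (1 / s))
    simpa using h2
  refine tendsto_of_tendsto_of_tendsto_of_le_of_le' tendsto_const_nhds hgap
    (Eventually.of_forall fun ε => hx s hs (mem_univ _)) ?_
  filter_upwards [hlog.eventually_ge_atTop 1, self_mem_nhdsWithin] with ε hL hε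
  have hε : 0 < ε := hε
  -- Identifies the initial scale `exp(-L)` with `ε` when `L = log (1/ε)`.
  have hexp : Real.exp (-Real.log (1 / ε)) = ε := by
    rw [one_div, Real.log_inv, neg_neg, Real.exp_log hε]
  have h1 := hA (Real.log (1 / ε)) (u ε) (v ε) hL (by rw [hexp]; exact huv ε hε)
  rw [← DLN.smul_timeAverage _ _ hs (by linarith), DLN.scaledLasso_smul _ hs,
    DLN.scaledLasso_smul _ hs, ← mul_sub] at h1
  have h2 : 0 < s ^ 2 := by positivity
  rw [← sub_le_iff_le_add', le_div_iff₀ h2]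
  linarith
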